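/- For $R\ge 1$ and $\alpha,\beta>0$, let $\mathcal A_N(R,\alpha,\beta)$ be the set of all everywhere differentiable bijections $\mathcal F:\mathbb R^N\to\mathbb R^N$ such that, with $B_R=\{x\in\mathbb R^N:\|x\|_2\le R\}$, (i) $\|(\mathcal F'(x)-\mathcal F'(y))z\|_2\le\alpha\|x-y\|_2\|z\|_2$ for all $x,y\in B_R$ and $z\in\mathbb R^N$; (ii) $\|\mathcal F^{-1}(u)-\mathcal F^{-1}(v)\|_2\le\beta\|u-v\|_2$ for all $u,v\in\mathcal F(B_R)$; (iii) $\det\mathcal F'(x_0)>0$ for some $x_0\in B_R$. Theorem. For every $N$ and every $K$ there is a constant $c_1>0$ (depending only on $N$ and $K$) with the following property. Let $R\ge1$, $\alpha,\beta>0$ and $\mathcal F\in\mathcal A_N(R,\alpha,\beta)$ with $\|\mathcal F'(0)\|_2\le K$ (operator norm), and let $L\ge1$. Then there are differentiable maps $F_1,\dots,F_L:\mathbb R^N\to\mathbb R^N$ such that the residual network $x_{l+1}=x_l+F_l(x_l)$, $l=1,\dots,L$, represents $\mathcal F$ on the unit ball, that is, $x_{L+1}=\mathcal F(x_1)$ for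 every input $x_1$ with $\|x_1\|_2\le1$, and such that for every such input $x_1$, every cost function $\mathcal E:\mathbb R^N\to\mathbb R$ of the output that is differentiable at $x_{L+1}$, and every block $l=1,\dots,L$, $$(1-\delta)\left\|\frac{\partial\mathcal E}{\partial x_{l+1}}\right\|_2\le\left\|\frac{\partial\mathcal E}{\partial x_l}\right\|_2\le(1+\delta)\left\|\frac{\partial\mathcal E}{\partial x_{l+1}}\right\|_2,$$ where $\frac{\partial\mathcal E}{\partial x_l}$ is the gradient of the cost of the network output, regarded as a function of the signal $x_l$ entering block $l$, and $$\delta=c\,\frac{\log(2L)}{L},\qquad c=c_1\max\{\alpha\beta(1+\beta),\ \beta(2+\alpha)+\alpha\}.$$ -/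

import Mathlib

/-- `N`-dimensional Euclidean space. -/
abbrev Vec (N : ℕ) : Type := EuclideanSpace ℝ (Fin N)

/-- The assumptions on the map to be represented: `F` is an invertible, everywhere differentiable
self-map of `ℝ^N` which, at points of norm at most `R`, has an `α`-Lipschitz derivative, whose
inverse is `β`-Lipschitz on the image of that ball, and whose Jacobian determinant is positive at
some point of norm at most `R`. -/
structure MapAssumption {N : ℕ} (F : Vec N ≃ Vec N) (R α β : ℝ) : Prop where
  differentiable : Differentiable ℝ F
  alpha_pos : 0 < α
  beta_pos : 0 < β
  smooth : ∀ x y z : Vec N, ‖x‖ ≤ R → ‖y‖ ≤ R →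
    ‖(fderiv ℝ F x - fderiv ℝ F y) z‖ ≤ α * ‖x - y‖ * ‖z‖
  lipschitz_inverse : ∀ u v : Vec N, ‖F.symm u‖ ≤ R → ‖F.symm v‖ ≤ R →
    ‖F.symm u - F.symm v‖ ≤ β * ‖u - v‖
  det_pos : ∃ x : Vec N, ‖x‖ ≤ R ∧ 0 < (fderiv ℝ F x).det

/-- Feed `x` through the `k` consecutive residual blocks `y ↦ y + f j y`,
`j = l, l + 1, …, l + k - 1`. -/
def runBlocks {N : ℕ} (f : ℕ → Vec N → Vec N) : ℕ → ℕ → Vec N → Vec N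
  | _, 0, x => x
  | l, k + 1, x => runBlocks f (l + 1) k (x + f l x)

/-- The signal entering block `l` (blocks are counted from `0`) when the network input is `x`;
for `l = L` it is the output of the network made of the blocks `0, …, L - 1`. -/
def activation {N : ℕ} (f : ℕ → Vec N → Vec N) (x : Vec N) (l : ℕ) : Vec N :=
  runBlocks f 0 l x

/-- The gradient of the cost `E` (a function of the output of the `L`-block network) with respect
to the signal entering block `l`, for the network input `x`; for `l = L`, it is the gradient with
respect to the output. -/
noncomputable def backpropGradient {N : ℕ} (f : ℕ → Vec N → Vec N) (L : ℕ) (E : Vec N → ℝ)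
    (x : Vec N) (l : ℕ) : Vec N :=
  gradient (fun y => E (runBlocks f l (L - l) y)) (activation f x l)

/-- The coefficient `δ = c log(2L)/L`, where
`c = c₁ max {αβ(1 + β), β(2 + α) + α}`. -/
noncomputable def gradientDelta (c₁ α β : ℝ) (L : ℕ) : ℝ :=
  c₁ * max (α * β * (1 + β)) (β * (2 + α) + α) * (Real.log (2 * (L : ℝ)) / (L : ℝ))

/-! The network is built from its states. If Φ_0 = id, …, Φ_L = F are injective near the unit ball,
block l has to be Φ_{l+1} ∘ Φ_l⁻¹ − id, with derivative (Φ'_{l+1}(x) − Φ'_l(x)) Φ'_l(x)⁻¹ at Φ_l(x).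
Backpropagation composes the derivative of the cost with the identity plus this map, so a bound δ on
its norm gives both gradient inequalities. It remains to join id to F by a path whose derivative has
bounded relative speed, and to cut it into L pieces. This gives δ = O(1/L); the logarithm is slack.

The path has two stages. With G = F'(0)⁻¹ ∘ F, the dilations t⁻¹(G(tx) − G(0)) + tG(0) join id to G;
their derivative G'(tx) is Lipschitz in t, with relative speed at most αβ²K
(`exists_dilation_block`). Then G is composed with a path of invertible linear maps from id to F'(0)
(`exists_linear_path`). Such a path exists because det F'(0) > 0: in F'(0) = QP, the positive factor
P is reached along a segment, and Q, a product of evenly many reflections, by turning their mirrors.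
Finally βK ≥ 1 absorbs all constants into c. -/

/-! ### Residual blocks and backpropagated gradients. -/

theorem exists_residual_block {E : Type*} [NormedAddCommGroup E] [InnerProductSpace ℝ E]
    [FiniteDimensional ℝ E] {V S : Set E} (hV : IsOpen V) (hS : IsCompact S) (hSV : S ⊆ V)
    {Φ Ψ : E → E} {Φ' Ψ' : E → E →L[ℝ] E} (hinj : Set.InjOn Φ V)
    (hΦ : ∀ x ∈ V, HasStrictFDerivAt Φ (Φ' x) x)
    (hΦ' : ∀ x ∈ V, Function.Injective (Φ' x))
    (hΨ : ∀ x ∈ V, HasFDerivAt Ψ (Ψ' x) x) {δ : ℝ} (hδ : 0 ≤ δ)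
    (h : ∀ x ∈ S, ∀ z, ‖Ψ' x z - Φ' x z‖ ≤ δ * ‖Φ' x z‖) :
    ∃ f : E → E, Differentiable ℝ f ∧
      ∀ x ∈ S, Ψ x = Φ x + f (Φ x) ∧ ‖fderiv ℝ f (Φ x)‖ ≤ δ := by
  have he : ∀ x ∈ V, ∃ e : E ≃L[ℝ] E, (e : E →L[ℝ] E) = Φ' x := fun x hx =>
    ⟨(LinearEquiv.ofInjectiveEndo (Φ' x : E →ₗ[ℝ] E) (hΦ' x hx)).toContinuousLinearEquiv, rfl⟩
  choose! e he using he
  have hez : ∀ x ∈ V, ∀ z, e x z = Φ' x z := fun x hx z => by rw [← he x hx]; rfl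
  replace hΦ : ∀ x ∈ V, HasStrictFDerivAt Φ (e x : E →L[ℝ] E) x := fun x hx => by
    rw [he x hx]; exact hΦ x hx
  -- By the inverse function theorem `Φ` is open on `V`.
  have hW : IsOpen (Φ '' V) := by
    rw [isOpen_iff_mem_nhds]
    rintro _ ⟨x, hx, rfl⟩
    rw [← (hΦ x hx).map_nhds_eq_of_equiv]
    exact Filter.image_mem_map (hV.mem_nhds hx)
  have hT : IsClosed (Φ '' S) := by
    refine (hS.image_of_continuousOn fun x hx => ?_).isClosed
    exact (hΦ x (hSV hx)).hasFDerivAt.continuousAt.continuousWithinAt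
  have hdisj : Disjoint (Φ '' V)ᶜ (Φ '' S) :=
    Set.disjoint_left.2 fun y hy hy' => hy (Set.image_mono hSV hy')
  -- The inverse of `Φ` lives only on `Φ '' V`, but the block must be differentiable everywhere. The
  -- cutoff is 1 near `Φ '' S`, so it does not alter the derivative there.
  obtain ⟨χ, h0, h1, -⟩ := exists_contMDiffMap_zero_one_nhds_of_isClosed (n := 1)
    (modelWithCornersSelf ℝ E) hW.isClosed_compl hT hdisj
  have hχ : Differentiable ℝ χ := χ.contMDiff.contDiff.differentiable one_ne_zero
  set g : E → E := Function.invFunOn Φ V with hg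
  have hgl : ∀ x ∈ V, g (Φ x) = x := fun x hx => hinj.leftInvOn_invFunOn hx
  have hg' : ∀ x ∈ V, HasFDerivAt g ((e x).symm : E →L[ℝ] E) (Φ x) := fun x hx =>
    ((hΦ x hx).to_local_left_inverse
      (Filter.eventually_of_mem (hV.mem_nhds hx) hgl)).hasFDerivAt
  have hk : ∀ x ∈ V, HasFDerivAt (fun y => Ψ (g y) - y)
      ((Ψ' x).comp ((e x).symm : E →L[ℝ] E) - ContinuousLinearMap.id ℝ E) (Φ x) := by
    intro x hx
    have h2 : HasFDerivAt Ψ (Ψ' x) (g (Φ x)) := by rw [hgl x hx]; exact hΨ x hx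
    exact (h2.comp (Φ x) (hg' x hx)).sub (hasFDerivAt_id _)
  refine ⟨fun y => χ y • (Ψ (g y) - y), fun y => ?_, fun x hx => ⟨?_, ?_⟩⟩
  · by_cases hy : y ∈ Φ '' V
    · obtain ⟨x, hx, rfl⟩ := hy
      exact (hχ _).smul (hk x hx).differentiableAt
    · have h3 : ∀ᶠ w in nhds y, χ w = 0 := h0.filter_mono (nhds_le_nhdsSet hy)
      have h4 : (fun y => χ y • (Ψ (g y) - y)) =ᶠ[nhds y] fun _ => 0 :=
        h3.mono fun w hw => by simp [hw]
      exact h4.differentiableAt_iff.2 (differentiableAt_const _)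
  · have h3 : χ (Φ x) = 1 :=
      (h1.filter_mono (nhds_le_nhdsSet (Set.mem_image_of_mem Φ hx))).self_of_nhds
    simp [h3, hgl x (hSV hx)]
  · have h3 : ∀ᶠ w in nhds (Φ x), χ w = 1 :=
      h1.filter_mono (nhds_le_nhdsSet (Set.mem_image_of_mem Φ hx))
    have h4 : (fun y => χ y • (Ψ (g y) - y)) =ᶠ[nhds (Φ x)] fun y => Ψ (g y) - y :=
      h3.mono fun w hw => by simp [hw]
    rw [h4.fderiv_eq, (hk x (hSV hx)).fderiv]
    refine ContinuousLinearMap.opNorm_le_bound _ hδ fun w => ?_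
    simpa [← hez x (hSV hx)] using h x hx ((e x).symm w)

theorem runBlocks_succ_end {N : ℕ} (f : ℕ → Vec N → Vec N) (l k : ℕ) (x : Vec N) :
    runBlocks f l (k + 1) x = runBlocks f l k x + f (l + k) (runBlocks f l k x) := by
  induction k generalizing l x with
  | zero => simp [runBlocks]
  | succ k ih =>
    rw [runBlocks, ih, runBlocks]
    rw [show l + 1 + k = l + (k + 1) by omega]

theorem differentiable_runBlocks {N : ℕ} {f : ℕ → Vec N → Vec N} {l k : ℕ}
    (hf : ∀ j < l + k, Differentiable ℝ (f j)) : Differentiable ℝ (runBlocks f l k) := by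
  induction k with
  | zero => exact differentiable_id
  | succ k ih =>
    have h1 := ih fun j hj => hf j (by omega)
    have h2 : runBlocks f l (k + 1) = fun x => runBlocks f l k x + f (l + k) (runBlocks f l k x) :=
      funext fun x => runBlocks_succ_end f l k x
    rw [h2]
    exact h1.add ((hf (l + k) (by omega)).comp h1)

theorem runBlocks_add {N : ℕ} (f : ℕ → Vec N → Vec N) (l k j : ℕ) (x : Vec N) :
    runBlocks f (l + k) j (runBlocks f l k x) = runBlocks f l (k + j) x := by
  induction j with
  | zero => rfl
  | succ j ih => rw [runBlocks_succ_end, ih, ← add_assoc, runBlocks_succ_end, add_assoc]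

theorem norm_backpropGradient {N : ℕ} (f : ℕ → Vec N → Vec N) (L : ℕ) (E : Vec N → ℝ)
    (x : Vec N) (l : ℕ) : ‖backpropGradient f L E x l‖ =
      ‖fderiv ℝ (fun y => E (runBlocks f l (L - l) y)) (activation f x l)‖ := by
  rw [backpropGradient, gradient, LinearIsometryEquiv.norm_map]

/-- A network all of whose blocks have a small derivative along the signals keeps the norms of the
gradients almost constant. -/
theorem norm_backpropGradient_bounds {N : ℕ} {f : ℕ → Vec N → Vec N} {L l : ℕ} {E : Vec N → ℝ}
    {x : Vec N} {δ : ℝ} (hf : ∀ j < L, Differentiable ℝ (f j)) (hl : l < L)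
    (hE : DifferentiableAt ℝ E (activation f x L))
    (hδ : ‖fderiv ℝ (f l) (activation f x l)‖ ≤ δ) :
    (1 - δ) * ‖backpropGradient f L E x (l + 1)‖ ≤ ‖backpropGradient f L E x l‖ ∧
      ‖backpropGradient f L E x l‖ ≤ (1 + δ) * ‖backpropGradient f L E x (l + 1)‖ := by
  obtain ⟨k, rfl⟩ : ∃ k, L = l + 1 + k := ⟨L - (l + 1), by omega⟩
  set y := activation f x l with hy
  have hy1 : activation f x (l + 1) = y + f l y := by
    rw [hy, activation, runBlocks_succ_end, zero_add]; rfl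
  rw [norm_backpropGradient, norm_backpropGradient, hy1, ← hy]
  have e1 : l + 1 + k - l = k + 1 := by omega
  have e2 : l + 1 + k - (l + 1) = k := by omega
  rw [e1, e2]
  set g : Vec N → ℝ := fun z => E (runBlocks f (l + 1) k z) with hg
  have hout : runBlocks f (l + 1) k (y + f l y) = activation f x (l + 1 + k) := by
    rw [← hy1, activation, activation, ← runBlocks_add f 0 (l + 1) k x, zero_add]
  have hgd : DifferentiableAt ℝ g (y + f l y) := by
    refine DifferentiableAt.comp (g := E) (y + f l y) ?_ (differentiable_runBlocks hf _)
    rw [hout]; exact hE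
  -- Chain rule: the derivative of the cost before the block is `a ∘ (id + f')`, which differs from
  -- `a` by at most `δ * ‖a‖`.
  have hd : HasFDerivAt (fun z => E (runBlocks f l (k + 1) z))
      ((fderiv ℝ g (y + f l y)).comp (ContinuousLinearMap.id ℝ _ + fderiv ℝ (f l) y)) y := by
    have := hgd.hasFDerivAt.comp y
      ((hasFDerivAt_id y).add (hf l (by omega) y).hasFDerivAt)
    exact this
  rw [hd.fderiv, ContinuousLinearMap.comp_add, ContinuousLinearMap.comp_id]
  set a := fderiv ℝ g (y + f l y)
  have hb : ‖a.comp (fderiv ℝ (f l) y)‖ ≤ δ * ‖a‖ :=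
    (a.opNorm_comp_le _).trans (by rw [mul_comm]; gcongr)
  constructor
  · have := norm_sub_le (a + a.comp (fderiv ℝ (f l) y)) (a.comp (fderiv ℝ (f l) y))
    rw [add_sub_cancel_right] at this
    linarith
  · have := norm_add_le a (a.comp (fderiv ℝ (f l) y))
    linarith

theorem exists_network_of_states {N L : ℕ} {F : Vec N → Vec N} {δ : ℝ} {S : Set (Vec N)}
    (Φ : ℕ → Vec N → Vec N) (h0 : ∀ x ∈ S, Φ 0 x = x) (hL : ∀ x ∈ S, Φ L x = F x)
    (hstep : ∀ l < L, ∃ f : Vec N → Vec N, Differentiable ℝ f ∧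
      ∀ x ∈ S, Φ (l + 1) x = Φ l x + f (Φ l x) ∧ ‖fderiv ℝ f (Φ l x)‖ ≤ δ) :
    ∃ f : ℕ → Vec N → Vec N,
      (∀ l < L, Differentiable ℝ (f l)) ∧
      (∀ x ∈ S, activation f x L = F x) ∧
      ∀ (E : Vec N → ℝ), ∀ x ∈ S, DifferentiableAt ℝ E (F x) →
        ∀ l < L,
          (1 - δ) * ‖backpropGradient f L E x (l + 1)‖ ≤ ‖backpropGradient f L E x l‖ ∧
          ‖backpropGradient f L E x l‖ ≤ (1 + δ) * ‖backpropGradient f L E x (l + 1)‖ := by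
  choose! f hf hf' using hstep
  have hact : ∀ x ∈ S, ∀ l ≤ L, activation f x l = Φ l x := by
    intro x hx l hl
    induction l with
    | zero => rw [h0 x hx]; rfl
    | succ l ih =>
      rw [(hf' l hl x hx).1, ← ih (by omega), activation, runBlocks_succ_end, zero_add]; rfl
  refine ⟨f, hf, fun x hx => by rw [hact x hx L le_rfl, hL x hx], fun E x hx hE l hl => ?_⟩
  refine norm_backpropGradient_bounds hf hl ?_ ?_
  · rwa [hact x hx L le_rfl, hL x hx]
  · rw [hact x hx l hl.le]; exact (hf' l hl x hx).2

/-! ### Paths of linear maps from the identity to a map of positive determinant. -/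

section LinearPaths

variable {E : Type*} [NormedAddCommGroup E] [InnerProductSpace ℝ E]

/-- `φ` and `ψ` are joined by a path of linear isometries that is `C`-Lipschitz on `[0, 1]`. -/
def JoinedByIsometries (φ ψ : E →L[ℝ] E) (C : ℝ) : Prop :=
  ∃ γ : ℝ → E →L[ℝ] E, γ 0 = φ ∧ γ 1 = ψ ∧ (∀ t ∈ Set.Icc (0 : ℝ) 1, ∀ x, ‖γ t x‖ = ‖x‖) ∧
    ∀ s ∈ Set.Icc (0 : ℝ) 1, ∀ t ∈ Set.Icc (0 : ℝ) 1, ∀ x,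
      ‖γ s x - γ t x‖ ≤ C * |s - t| * ‖x‖

theorem JoinedByIsometries.refl {φ : E →L[ℝ] E} (hφ : ∀ x, ‖φ x‖ = ‖x‖) :
    JoinedByIsometries φ φ 0 :=
  ⟨fun _ => φ, rfl, rfl, fun _ _ => hφ, fun _ _ _ _ x => by simp⟩

theorem JoinedByIsometries.mono {φ ψ : E →L[ℝ] E} {C C' : ℝ} (h : JoinedByIsometries φ ψ C)
    (hC : C ≤ C') : JoinedByIsometries φ ψ C' := by
  obtain ⟨γ, h0, h1, hi, hl⟩ := h
  exact ⟨γ, h0, h1, hi, fun s hs t ht x => (hl s hs t ht x).trans (by gcongr)⟩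

theorem JoinedByIsometries.comp {φ ψ φ' ψ' : E →L[ℝ] E} {C C' : ℝ}
    (h : JoinedByIsometries φ ψ C) (h' : JoinedByIsometries φ' ψ' C') :
    JoinedByIsometries (φ.comp φ') (ψ.comp ψ') (C + C') := by
  obtain ⟨γ, rfl, rfl, hi, hl⟩ := h
  obtain ⟨γ', rfl, rfl, hi', hl'⟩ := h'
  refine ⟨fun t => (γ t).comp (γ' t), rfl, rfl, fun t ht x => ?_, fun s hs t ht x => ?_⟩
  · simp [hi t ht, hi' t ht]
  · have h1 := hl s hs t ht (γ' s x)
    rw [hi' s hs] at h1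
    have h2 := hl' s hs t ht x
    rw [← hi t ht, map_sub] at h2
    calc ‖γ s (γ' s x) - γ t (γ' t x)‖
        ≤ ‖γ s (γ' s x) - γ t (γ' s x)‖ + ‖γ t (γ' s x) - γ t (γ' t x)‖ :=
          norm_sub_le_norm_sub_add_norm_sub _ _ _
      _ ≤ (C + C') * |s - t| * ‖x‖ := by linarith

/-- The reflection in the hyperplane orthogonal to `v`. -/
noncomputable def hyperplaneReflection (v : E) : E →L[ℝ] E :=
  ((ℝ ∙ v)ᗮ.reflection.toContinuousLinearEquiv : E →L[ℝ] E)

theorem hyperplaneReflection_apply (v x : E) :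
    hyperplaneReflection v x = (ℝ ∙ v)ᗮ.reflection x := rfl

theorem norm_hyperplaneReflection_apply (v x : E) : ‖hyperplaneReflection v x‖ = ‖x‖ :=
  LinearIsometryEquiv.norm_map _ x

theorem hyperplaneReflection_smul {c : ℝ} (hc : c ≠ 0) (v : E) :
    hyperplaneReflection (c • v) = hyperplaneReflection v := by
  ext x
  rw [hyperplaneReflection_apply, hyperplaneReflection_apply]
  simp only [Submodule.span_singleton_smul_eq (IsUnit.mk0 c hc) v]

theorem hyperplaneReflection_comp_self (v : E) :
    (hyperplaneReflection v).comp (hyperplaneReflection v) = ContinuousLinearMap.id ℝ E := by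
  ext x
  simp [hyperplaneReflection_apply]

theorem hyperplaneReflection_apply_of_norm_eq_one {v : E} (hv : ‖v‖ = 1) (x : E) :
    hyperplaneReflection v x = x - (2 * inner ℝ v x) • v := by
  rw [hyperplaneReflection_apply, Submodule.reflection_orthogonal_apply,
    Submodule.reflection_singleton_apply]
  simp [hv, two_smul, two_mul, add_smul]

theorem norm_hyperplaneReflection_sub_le {v w : E} (hv : ‖v‖ = 1) (hw : ‖w‖ = 1) (x : E) :
    ‖hyperplaneReflection v x - hyperplaneReflection w x‖ ≤ 4 * ‖v - w‖ * ‖x‖ := by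
  rw [hyperplaneReflection_apply_of_norm_eq_one hv, hyperplaneReflection_apply_of_norm_eq_one hw]
  have h : x - (2 * inner ℝ v x) • v - (x - (2 * inner ℝ w x) • w) =
      -((2 * inner ℝ (v - w) x) • v + (2 * inner ℝ w x) • (v - w)) := by
    rw [inner_sub_left]; module
  rw [h, norm_neg]
  refine (norm_add_le _ _).trans ?_
  rw [norm_smul, norm_smul, hv, norm_mul, norm_mul]
  have h1 := norm_inner_le_norm (𝕜 := ℝ) (v - w) x
  have h2 := norm_inner_le_norm (𝕜 := ℝ) w x
  rw [hw] at h2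
  have h3 : ‖(2 : ℝ)‖ = 2 := by norm_num
  rw [h3]
  have h4 := mul_le_mul_of_nonneg_right h2 (norm_nonneg (v - w))
  linarith

theorem norm_normalize_sub_normalize_le {v w : E} (hv : v ≠ 0) (hw : w ≠ 0) :
    ‖‖v‖⁻¹ • v - ‖w‖⁻¹ • w‖ ≤ 2 * ‖v‖⁻¹ * ‖v - w‖ := by
  have hv' := norm_pos_iff.2 hv
  have hw' := norm_pos_iff.2 hw
  have h : ‖v‖⁻¹ • v - ‖w‖⁻¹ • w = ‖v‖⁻¹ • (v - w) + (‖v‖⁻¹ * ‖w‖⁻¹ * (‖w‖ - ‖v‖)) • w := by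
    have : ‖v‖⁻¹ * ‖w‖⁻¹ * (‖w‖ - ‖v‖) = ‖v‖⁻¹ - ‖w‖⁻¹ := by field_simp
    rw [this]; module
  rw [h]
  refine (norm_add_le _ _).trans ?_
  rw [norm_smul, norm_smul, norm_mul, norm_mul, norm_inv, norm_inv, norm_norm, norm_norm]
  have h1 : ‖‖w‖ - ‖v‖‖ ≤ ‖v - w‖ := by
    rw [norm_sub_rev v w]; exact abs_norm_sub_norm_le w v
  have h2 : ‖v‖⁻¹ * ‖w‖⁻¹ * ‖‖w‖ - ‖v‖‖ * ‖w‖ = ‖v‖⁻¹ * ‖‖w‖ - ‖v‖‖ := by field_simp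
  rw [h2]
  have h3 := mul_le_mul_of_nonneg_left h1 (inv_nonneg.2 hv'.le)
  linarith

theorem joinedByIsometries_hyperplaneReflection_of_inner_nonneg {v w : E} (hv : ‖v‖ = 1)
    (hw : ‖w‖ = 1) (h : 0 ≤ inner ℝ v w) :
    JoinedByIsometries (hyperplaneReflection v) (hyperplaneReflection w) 32 := by
  set p : ℝ → E := fun t => (1 - t) • v + t • w with hp
  -- Since `v` and `w` make no obtuse angle, ‖p t‖² ≥ (1 − t)² + t² ≥ 1/2: the segment avoids 0 and
  -- can be normalized.
  have hpn : ∀ t ∈ Set.Icc (0 : ℝ) 1, 1 / 2 ≤ ‖p t‖ := by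
    intro t ht
    have h1 : ‖p t‖ ^ 2 = (1 - t) ^ 2 + 2 * ((1 - t) * t * inner ℝ v w) + t ^ 2 := by
      rw [hp, norm_add_sq_real, norm_smul, norm_smul, hv, hw, real_inner_smul_left,
        real_inner_smul_right]
      simp [sq_abs]; ring
    have h2 : 0 ≤ (1 - t) * t * inner ℝ v w :=
      mul_nonneg (mul_nonneg (sub_nonneg.2 ht.2) ht.1) h
    nlinarith [norm_nonneg (p t), sq_nonneg (1 - 2 * t)]
  have hpne : ∀ t ∈ Set.Icc (0 : ℝ) 1, p t ≠ 0 := fun t ht =>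
    norm_pos_iff.1 (by linarith [hpn t ht])
  refine ⟨fun t => hyperplaneReflection (p t), by simp [hp], by simp [hp],
    fun t _ x => norm_hyperplaneReflection_apply _ x, fun s hs t ht x => ?_⟩
  have e : ∀ t ∈ Set.Icc (0 : ℝ) 1,
      hyperplaneReflection (p t) = hyperplaneReflection (‖p t‖⁻¹ • p t) := fun t ht =>
    (hyperplaneReflection_smul (inv_ne_zero (norm_ne_zero_iff.2 (hpne t ht))) _).symm
  have hone : ∀ t ∈ Set.Icc (0 : ℝ) 1, ‖‖p t‖⁻¹ • p t‖ = 1 := fun t ht =>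
    norm_smul_inv_norm (𝕜 := ℝ) (hpne t ht)
  have h3 : ‖p s - p t‖ ≤ 2 * |s - t| := by
    have : p s - p t = (s - t) • (w - v) := by simp only [hp]; module
    rw [this, norm_smul, Real.norm_eq_abs, mul_comm]
    gcongr
    exact (norm_sub_le _ _).trans (by rw [hv, hw]; norm_num)
  have h4 : ‖p s‖⁻¹ ≤ 2 := by
    rw [inv_le_comm₀ (by linarith [hpn s hs]) two_pos]; linarith [hpn s hs]
  have h5 : ‖‖p s‖⁻¹ • p s - ‖p t‖⁻¹ • p t‖ ≤ 8 * |s - t| :=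
    calc _ ≤ 2 * ‖p s‖⁻¹ * ‖p s - p t‖ := norm_normalize_sub_normalize_le (hpne s hs) (hpne t ht)
      _ ≤ 2 * 2 * (2 * |s - t|) := by gcongr
      _ = 8 * |s - t| := by ring
  beta_reduce
  rw [e s hs, e t ht]
  calc _ ≤ 4 * ‖‖p s‖⁻¹ • p s - ‖p t‖⁻¹ • p t‖ * ‖x‖ :=
        norm_hyperplaneReflection_sub_le (hone s hs) (hone t ht) x
    _ ≤ 4 * (8 * |s - t|) * ‖x‖ := by gcongr
    _ = 32 * |s - t| * ‖x‖ := by ring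

/-- A mirror does not determine the sign of its normal, so `w` may be replaced by `-w` to make the
inner product nonnegative. -/
theorem joinedByIsometries_hyperplaneReflection {v w : E} (hv : ‖v‖ = 1) (hw : w ≠ 0) :
    JoinedByIsometries (hyperplaneReflection v) (hyperplaneReflection w) 32 := by
  have hw' : ‖w‖⁻¹ ≠ 0 := inv_ne_zero (norm_ne_zero_iff.2 hw)
  have hn : ‖‖w‖⁻¹ • w‖ = 1 := norm_smul_inv_norm (𝕜 := ℝ) hw
  rcases le_total 0 (inner ℝ v (‖w‖⁻¹ • w)) with h | h
  · rw [← hyperplaneReflection_smul hw' w]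
    exact joinedByIsometries_hyperplaneReflection_of_inner_nonneg hv hn h
  · rw [← hyperplaneReflection_smul (neg_ne_zero.2 hw') w]
    refine joinedByIsometries_hyperplaneReflection_of_inner_nonneg hv ?_ ?_
    · rw [neg_smul, norm_neg, hn]
    · rw [neg_smul, inner_neg_right]; linarith

variable [FiniteDimensional ℝ E]

/-- Every mirror is turned into the one orthogonal to `e`. Equal reflections cancel in pairs, so
only the parity of the number of nontrivial factors, read off from the determinant, survives. -/
theorem joinedByIsometries_list_prod {e : E} (he : ‖e‖ = 1) (l : List E) :
    (LinearMap.det (l.map fun v => (ℝ ∙ v)ᗮ.reflection).prod.toLinearMap = 1 ∧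
      JoinedByIsometries (ContinuousLinearMap.id ℝ E)
        (l.map fun v => (ℝ ∙ v)ᗮ.reflection).prod.toContinuousLinearEquiv (32 * l.length)) ∨
    (LinearMap.det (l.map fun v => (ℝ ∙ v)ᗮ.reflection).prod.toLinearMap = -1 ∧
      JoinedByIsometries (hyperplaneReflection e)
        (l.map fun v => (ℝ ∙ v)ᗮ.reflection).prod.toContinuousLinearEquiv (32 * l.length)) := by
  induction l with
  | nil =>
    left
    refine ⟨LinearMap.det_id, ?_⟩
    rw [List.length_nil, Nat.cast_zero, mul_zero]
    exact JoinedByIsometries.refl fun x => rfl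
  | cons v l ih =>
    set ψ := (l.map fun v => (ℝ ∙ v)ᗮ.reflection).prod with hψ
    have hdet : LinearMap.det ((v :: l).map fun v => (ℝ ∙ v)ᗮ.reflection).prod.toLinearMap =
        LinearMap.det (ℝ ∙ v)ᗮ.reflection.toLinearMap * LinearMap.det ψ.toLinearMap := by
      rw [← LinearMap.det_comp, List.map_cons, List.prod_cons]; rfl
    have hcomp : ((((v :: l).map fun v => (ℝ ∙ v)ᗮ.reflection).prod.toContinuousLinearEquiv :
        E ≃L[ℝ] E) : E →L[ℝ] E) =
        (hyperplaneReflection v).comp (ψ.toContinuousLinearEquiv : E →L[ℝ] E) := by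
      rw [List.map_cons, List.prod_cons]; rfl
    rw [hdet, hcomp, Submodule.det_reflection, Submodule.orthogonal_orthogonal]
    have hlen : 32 + 32 * (l.length : ℝ) = 32 * ((v :: l).length : ℝ) := by
      rw [List.length_cons]; push_cast; ring
    by_cases hv : v = 0
    · have h1 : hyperplaneReflection v = ContinuousLinearMap.id ℝ E := by
        ext x
        rw [hyperplaneReflection_apply, Submodule.reflection_orthogonal_apply,
          Submodule.reflection_singleton_apply]
        simp [hv]
      have h2 : Module.finrank ℝ (ℝ ∙ v) = 0 := by simp [hv]
      rw [h2, pow_zero, one_mul, h1, ContinuousLinearMap.id_comp]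
      exact ih.imp (fun h => ⟨h.1, h.2.mono (by linarith)⟩)
        fun h => ⟨h.1, h.2.mono (by linarith)⟩
    · rw [finrank_span_singleton hv, pow_one]
      have hj := joinedByIsometries_hyperplaneReflection he hv
      rcases ih with ⟨h1, h2⟩ | ⟨h1, h2⟩
      · right
        rw [h1]
        refine ⟨by norm_num, ?_⟩
        simpa [hlen] using hj.comp h2
      · left
        rw [h1]
        refine ⟨by norm_num, ?_⟩
        have := hj.comp h2
        rwa [hyperplaneReflection_comp_self, hlen] at this

theorem joinedByIsometries_id_of_det_pos [Nontrivial E] (φ : E ≃ₗᵢ[ℝ] E)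
    (hφ : 0 < LinearMap.det φ.toLinearMap) :
    JoinedByIsometries (ContinuousLinearMap.id ℝ E) φ.toContinuousLinearEquiv
      (32 * Module.finrank ℝ E) := by
  obtain ⟨e, he⟩ := exists_norm_eq E zero_le_one
  -- Cartan–Dieudonné: at most `finrank` reflections are needed, whence the constant.
  obtain ⟨l, hl, rfl⟩ := φ.reflections_generate_dim
  rcases joinedByIsometries_list_prod he l with ⟨-, h⟩ | ⟨h, -⟩
  · exact h.mono (by gcongr)
  · rw [h] at hφ; norm_num at hφ

/-- A form of the polar decomposition of an injective endomorphism `A`. -/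
theorem exists_isometry_mul_positive (A : E →L[ℝ] E) {β : ℝ}
    (hA : ∀ x, ‖x‖ ≤ β * ‖A x‖) :
    ∃ (Q : E ≃ₗᵢ[ℝ] E) (P : E →L[ℝ] E), (∀ x, A x = Q (P x)) ∧
      (∀ x, ‖x‖ ^ 2 ≤ β * inner ℝ (P x) x) ∧ 0 < LinearMap.det (P : E →ₗ[ℝ] E) := by
  have hsym : ((ContinuousLinearMap.adjoint A).comp A : E →L[ℝ] E).toLinearMap.IsSymmetric := by
    intro x y
    simp [ContinuousLinearMap.adjoint_inner_left, ContinuousLinearMap.adjoint_inner_right]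
  -- `A` maps an eigenbasis of A*A to orthogonal vectors; `Q` sends `b i` to the normalized `A (b
  -- i)`, and `P` is diagonal with the singular values `‖A (b i)‖`.
  set b := hsym.eigenvectorBasis (rfl : Module.finrank ℝ E = Module.finrank ℝ E) with hb
  have hAne : ∀ i, 0 < ‖A (b i)‖ := by
    intro i
    by_contra hc
    have h1 := hA (b i)
    have h2 : ‖A (b i)‖ = 0 := le_antisymm (not_lt.1 hc) (norm_nonneg _)
    rw [h2, b.orthonormal.1 i] at h1
    norm_num at h1
  have horth : ∀ i j, i ≠ j → inner ℝ (A (b i)) (A (b j)) = 0 := by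
    intro i j hij
    have h2 : ContinuousLinearMap.adjoint A (A (b i)) = hsym.eigenvalues rfl i • b i :=
      hsym.apply_eigenvectorBasis rfl i
    rw [← ContinuousLinearMap.adjoint_inner_left, h2, real_inner_smul_left,
      b.orthonormal.2 hij, mul_zero]
  have hon : Orthonormal ℝ fun i => ‖A (b i)‖⁻¹ • A (b i) := by
    refine ⟨fun i => norm_smul_inv_norm (𝕜 := ℝ) (norm_pos_iff.1 (hAne i)), fun i j hij => ?_⟩
    simp [real_inner_smul_left, real_inner_smul_right, horth i j hij]
  set c : OrthonormalBasis (Fin (Module.finrank ℝ E)) ℝ E :=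
    OrthonormalBasis.mk hon (hon.linearIndependent.span_eq_top_of_card_eq_finrank' (by simp)).ge
    with hc
  have hci : ∀ i, c i = ‖A (b i)‖⁻¹ • A (b i) := fun i => by simp [hc]
  set Q := b.equiv c (Equiv.refl _) with hQ
  have hQb : ∀ i, Q (b i) = c i := fun i => by simp [hQ]
  set P : E →L[ℝ] E := (Q.symm.toContinuousLinearEquiv : E →L[ℝ] E).comp A with hP
  have hPb : ∀ i, P (b i) = ‖A (b i)‖ • b i := by
    intro i
    have h1 : A (b i) = Q (‖A (b i)‖ • b i) := by
      rw [map_smul, hQb, hci, smul_smul, mul_inv_cancel₀ (hAne i).ne', one_smul]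
    change Q.symm (A (b i)) = _
    conv_lhs => rw [h1]
    simp
  refine ⟨Q, P, fun x => by simp [hP], fun x => ?_, ?_⟩
  · have hPx : ∀ i, inner ℝ (P x) (b i) = ‖A (b i)‖ * inner ℝ x (b i) := by
      intro i
      conv_lhs => rw [← b.sum_repr x]
      rw [map_sum, sum_inner]
      simp only [map_smul, hPb, real_inner_smul_left]
      rw [Finset.sum_eq_single i]
      · rw [b.repr_apply_apply, real_inner_self_eq_norm_sq, b.orthonormal.1 i,
          real_inner_comm]; ring
      · intro j _ hj; rw [b.orthonormal.2 hj]; ring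
      · simp
    have h1 : inner ℝ (P x) x = ∑ i, ‖A (b i)‖ * inner ℝ x (b i) ^ 2 := by
      rw [← b.sum_inner_mul_inner (P x) x]
      refine Finset.sum_congr rfl fun i _ => ?_
      rw [hPx, real_inner_comm x (b i)]; ring
    rw [h1, ← real_inner_self_eq_norm_sq, ← b.sum_inner_mul_inner x x, Finset.mul_sum]
    refine Finset.sum_le_sum fun i _ => ?_
    have h2 := hA (b i)
    rw [b.orthonormal.1 i] at h2
    rw [real_inner_comm x (b i)]
    nlinarith [sq_nonneg (inner ℝ x (b i))]
  · have h1 : LinearMap.toMatrix b.toBasis b.toBasis (P : E →ₗ[ℝ] E) =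
        Matrix.diagonal fun i => ‖A (b i)‖ := by
      ext i j
      rw [LinearMap.toMatrix_apply]
      simp [hPb, Matrix.diagonal_apply]
      grind
    rw [← LinearMap.det_toMatrix b.toBasis, h1, Matrix.det_diagonal]
    exact Finset.prod_pos fun i _ => hAne i

/-- An endomorphism with positive determinant is joined to the identity by a path of linear maps
whose relative speed is controlled by its norm and by the norm of its inverse. -/
theorem exists_linear_path [Nontrivial E] (A : E →L[ℝ] E) {K β : ℝ}
    (hdet : 0 < LinearMap.det (A : E →ₗ[ℝ] E)) (hK : ‖A‖ ≤ K) (hA : ∀ x, ‖x‖ ≤ β * ‖A x‖) :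
    ∃ γ : ℝ → E →L[ℝ] E, γ 0 = ContinuousLinearMap.id ℝ E ∧ γ 1 = A ∧
      ∀ s ∈ Set.Icc (0 : ℝ) 1, ∀ t ∈ Set.Icc (0 : ℝ) 1, ∀ x,
        ‖γ s x - γ t x‖ ≤
          (32 * Module.finrank ℝ E + (K + 1) * max 1 β) * |s - t| * ‖γ t x‖ := by
  obtain ⟨Q, P, hQP, hP, hPdet⟩ := exists_isometry_mul_positive A hA
  have hQdet : 0 < LinearMap.det Q.toLinearMap := by
    have h1 : (A : E →ₗ[ℝ] E) = Q.toLinearMap ∘ₗ (P : E →ₗ[ℝ] E) :=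
      LinearMap.ext fun x => hQP x
    rw [h1, LinearMap.det_comp] at hdet
    exact pos_of_mul_pos_left hdet hPdet.le
  obtain ⟨γ, h0, h1, hi, hl⟩ := joinedByIsometries_id_of_det_pos Q hQdet
  set p : ℝ → E →L[ℝ] E := fun t => (1 - t) • ContinuousLinearMap.id ℝ E + t • P with hp
  have hpx : ∀ t x, p t x = (1 - t) • x + t • P x := fun t x => by simp [hp]
  have hPn : ∀ x, ‖P x‖ ≤ K * ‖x‖ := fun x => by
    rw [← Q.norm_map, ← hQP]; exact A.le_of_opNorm_le hK x
  -- Quadratic forms bounded below are stable under convex combination, so the whole segment from id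
  -- to `P` is uniformly invertible.
  have hlow : ∀ t ∈ Set.Icc (0 : ℝ) 1, ∀ x, ‖x‖ ≤ max 1 β * ‖p t x‖ := by
    intro t ht x
    rcases eq_or_ne x 0 with rfl | hx
    · simp
    have hx' := norm_pos_iff.2 hx
    have h2 : inner ℝ (p t x) x = (1 - t) * ‖x‖ ^ 2 + t * inner ℝ (P x) x := by
      rw [hpx, inner_add_left, real_inner_smul_left, real_inner_smul_left,
        real_inner_self_eq_norm_sq]
    have h3 : 0 ≤ inner ℝ (P x) x := by
      by_contra hc
      push Not at hc
      have hβ : 0 ≤ β := by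
        by_contra hb
        nlinarith [hA x, norm_nonneg (A x)]
      nlinarith [hP x, sq_pos_of_pos hx']
    have h4 : ‖x‖ ^ 2 ≤ max 1 β * inner ℝ (p t x) x := by
      have h5 : ‖x‖ ^ 2 ≤ max 1 β * ‖x‖ ^ 2 :=
        le_mul_of_one_le_left (sq_nonneg _) (le_max_left _ _)
      have h6 : ‖x‖ ^ 2 ≤ max 1 β * inner ℝ (P x) x :=
        (hP x).trans (mul_le_mul_of_nonneg_right (le_max_right _ _) h3)
      rw [h2]
      nlinarith [mul_le_mul_of_nonneg_left h5 (sub_nonneg.2 ht.2),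
        mul_le_mul_of_nonneg_left h6 ht.1]
    have h7 : max 1 β * inner ℝ (p t x) x ≤ max 1 β * (‖p t x‖ * ‖x‖) :=
      mul_le_mul_of_nonneg_left (real_inner_le_norm _ _) (zero_le_one.trans (le_max_left _ _))
    nlinarith
  refine ⟨fun t => (γ t).comp (p t), ?_, ?_, fun s hs t ht x => ?_⟩
  · ext x; simp [h0, hpx]
  · ext x; simp [h1, hpx, hQP]
  · have h2 := hl s hs t ht (p t x)
    have h3 : ‖p s x - p t x‖ ≤ |s - t| * ((K + 1) * (max 1 β * ‖p t x‖)) := by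
      have h4 : p s x - p t x = (s - t) • (P x - x) := by rw [hpx, hpx]; module
      have h5 : ‖P x - x‖ ≤ (K + 1) * ‖x‖ :=
        (norm_sub_le _ _).trans (by linarith [hPn x])
      have hK1 : 0 ≤ K + 1 := by linarith [norm_nonneg A]
      rw [h4, norm_smul, Real.norm_eq_abs]
      gcongr
      exact h5.trans (mul_le_mul_of_nonneg_left (hlow t ht x) hK1)
    rw [← hi s hs, map_sub] at h3
    have h6 := norm_sub_le_norm_sub_add_norm_sub (γ s (p s x)) (γ s (p t x)) (γ t (p t x))
    simp only [ContinuousLinearMap.comp_apply]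
    rw [hi t ht (p t x)]
    linarith

end LinearPaths

/-! ### The dilation homotopy. -/

section Dilation

variable {E : Type*} [NormedAddCommGroup E] [InnerProductSpace ℝ E]

/-- The homotopy from the identity to `G` that shrinks the domain of `G` towards `0`. -/
noncomputable def dilation (G : E → E) (t : ℝ) (x : E) : E :=
  if t = 0 then x else t⁻¹ • (G (t • x) - G 0) + t • G 0

theorem dilation_zero (G : E → E) : dilation G 0 = id := by
  ext x; simp [dilation]

theorem dilation_one (G : E → E) : dilation G 1 = G := by
  ext x; simp [dilation]

theorem dilation_injective {G : E → E} (hG : Function.Injective G) (t : ℝ) :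
    Function.Injective (dilation G t) := by
  intro x y hxy
  by_cases ht : t = 0
  · simpa [dilation, ht] using hxy
  · simp only [dilation, ht, if_false, add_left_inj] at hxy
    have h1 := smul_right_injective E (inv_ne_zero ht) hxy
    exact smul_right_injective E ht (hG (sub_left_injective h1))

theorem hasStrictFDerivAt_dilation {G : E → E} {G' : E →L[ℝ] E} {t : ℝ} {x : E}
    (hG : HasStrictFDerivAt G G' (t • x)) (h0 : t = 0 → G' = ContinuousLinearMap.id ℝ E) :
    HasStrictFDerivAt (dilation G t) G' x := by
  by_cases ht : t = 0
  · rw [ht, dilation_zero, h0 ht]; exact hasStrictFDerivAt_id x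
  · have h1 : dilation G t = fun x => t⁻¹ • (G (t • x) - G 0) + t • G 0 := by
      ext x; simp [dilation, ht]
    rw [h1]
    have h2 := ((hG.comp x ((hasStrictFDerivAt_id x).const_smul t)).sub_const (G 0)).const_smul
      t⁻¹ |>.add_const (t • G 0)
    have h3 : t⁻¹ • G'.comp (t • ContinuousLinearMap.id ℝ E) = G' := by ext z; simp [ht]
    rw [h3] at h2
    exact h2

/-- The non-strict version serves the target state of a step, where `s • x` may leave the open ball
on which strict differentiability is known. -/
theorem hasFDerivAt_dilation {G : E → E} {G' : E →L[ℝ] E} {t : ℝ} {x : E}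
    (hG : HasFDerivAt G G' (t • x)) (h0 : t = 0 → G' = ContinuousLinearMap.id ℝ E) :
    HasFDerivAt (dilation G t) G' x := by
  by_cases ht : t = 0
  · rw [ht, dilation_zero, h0 ht]; exact hasFDerivAt_id x
  · have h1 : dilation G t = fun x => t⁻¹ • (G (t • x) - G 0) + t • G 0 := by
      ext x; simp [dilation, ht]
    rw [h1]
    have h2 := ((hG.comp x ((hasFDerivAt_id x).const_smul t)).sub_const (G 0)).const_smul
      t⁻¹ |>.add_const (t • G 0)
    have h3 : t⁻¹ • G'.comp (t • ContinuousLinearMap.id ℝ E) = G' := by ext z; simp [ht]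
    rw [h3] at h2
    exact h2

end Dilation

/-! ### Consequences of the assumptions on `F`. -/

namespace MapAssumption

variable {N : ℕ} {F : Vec N ≃ Vec N} {R α β : ℝ}

theorem norm_fderiv_sub_le (hF : MapAssumption F R α β) {x y : Vec N} (hx : ‖x‖ ≤ R)
    (hy : ‖y‖ ≤ R) : ‖fderiv ℝ F x - fderiv ℝ F y‖ ≤ α * ‖x - y‖ :=
  ContinuousLinearMap.opNorm_le_bound _ (mul_nonneg hF.alpha_pos.le (norm_nonneg _))
    fun z => hF.smooth x y z hx hy

theorem continuousOn_fderiv (hF : MapAssumption F R α β) :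
    ContinuousOn (fderiv ℝ F) (Metric.closedBall 0 R) := by
  refine (LipschitzOnWith.of_dist_le_mul (K := ⟨α, hF.alpha_pos.le⟩)
    fun x hx y hy => ?_).continuousOn
  rw [dist_eq_norm, dist_eq_norm]
  exact hF.norm_fderiv_sub_le (by simpa using hx) (by simpa using hy)

/-- The Lipschitz bound for the inverse, divided by the increment, passes to the limit; `‖x‖ < R`
keeps the nearby points in the ball. -/
theorem norm_le_norm_fderiv (hF : MapAssumption F R α β) {x : Vec N} (hx : ‖x‖ < R)
    (z : Vec N) : ‖z‖ ≤ β * ‖fderiv ℝ F x z‖ := by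
  have h1 := ((hF.differentiable x).hasFDerivAt.hasLineDerivAt z).tendsto_slope_zero
  refine ge_of_tendsto (h1.norm.const_mul β) ?_
  have hc : Filter.Tendsto (fun t : ℝ => x + t • z) (nhds 0) (nhds x) := by
    have : Continuous fun t : ℝ => x + t • z := by fun_prop
    simpa using this.tendsto 0
  have h2 : ∀ᶠ t : ℝ in nhds 0, ‖x + t • z‖ < R := by
    have := hc.eventually ((continuous_norm.tendsto x).eventually (gt_mem_nhds hx))
    exact this
  filter_upwards [h2.filter_mono nhdsWithin_le_nhds, self_mem_nhdsWithin] with t ht ht0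
  have h3 := hF.lipschitz_inverse (F (x + t • z)) (F x) (by simpa using ht.le)
    (by simpa using hx.le)
  simp only [Equiv.symm_apply_apply, add_sub_cancel_left] at h3
  have ht' : 0 < |t| := abs_pos.2 ht0
  rw [norm_smul, Real.norm_eq_abs] at h3
  rw [norm_smul, norm_inv, Real.norm_eq_abs]
  have h4 : ‖z‖ ≤ |t|⁻¹ * (β * ‖F (x + t • z) - F x‖) := by
    rw [← div_eq_inv_mul, le_div_iff₀ ht']; linarith
  linarith

theorem fderiv_injective (hF : MapAssumption F R α β) {x : Vec N} (hx : ‖x‖ < R) :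
    Function.Injective (fderiv ℝ F x) := by
  refine (injective_iff_map_eq_zero _).2 fun z hz => ?_
  have := hF.norm_le_norm_fderiv hx z
  rw [hz] at this
  simpa using this

theorem hasStrictFDerivAt (hF : MapAssumption F R α β) {x : Vec N} (hx : ‖x‖ < R) :
    HasStrictFDerivAt F (fderiv ℝ F x) x :=
  hasStrictFDerivAt_of_hasFDerivAt_of_continuousAt
    (Filter.Eventually.of_forall fun y => (hF.differentiable y).hasFDerivAt)
    (hF.continuousOn_fderiv.continuousAt (Metric.closedBall_mem_nhds_of_mem (by simpa using hx)))

/-- The determinant cannot vanish in the open ball, so it keeps its sign along the segment from 0 to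
`x`. The point `x` may lie on the sphere, but there positivity is assumed. -/
theorem det_fderiv_zero_pos (hF : MapAssumption F R α β) (hR : 0 < R) :
    0 < LinearMap.det (fderiv ℝ F 0 : Vec N →ₗ[ℝ] Vec N) := by
  obtain ⟨x, hx, hdet⟩ := hF.det_pos
  by_contra hneg
  have hcont : ContinuousOn (fun s : ℝ => (fderiv ℝ F (s • x)).det) (Set.Icc 0 1) := by
    refine ContinuousLinearMap.continuous_det.comp_continuousOn
      (hF.continuousOn_fderiv.comp (by fun_prop) fun s hs => ?_)
    rw [mem_closedBall_zero_iff, norm_smul, Real.norm_eq_abs, abs_of_nonneg hs.1]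
    exact (mul_le_of_le_one_left (norm_nonneg _) hs.2).trans hx
  obtain ⟨s, hs, hs0⟩ := intermediate_value_Icc zero_le_one hcont
    (show (0 : ℝ) ∈ _ from ⟨by simpa using hneg, by simpa using hdet.le⟩)
  have hs1 : s < 1 := by
    refine lt_of_le_of_ne hs.2 fun h => ?_
    simp only [h, one_smul] at hs0
    exact hdet.ne' hs0
  have hsx : ‖s • x‖ < R := by
    rw [norm_smul, Real.norm_eq_abs, abs_of_nonneg hs.1]
    exact (mul_le_mul_of_nonneg_left hx hs.1).trans_lt (mul_lt_of_lt_one_left hR hs1)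
  exact (LinearMap.bot_lt_ker_of_det_eq_zero hs0).ne'
    (LinearMap.ker_eq_bot.2 (hF.fderiv_injective hsx))

theorem one_le_mul [Nontrivial (Vec N)] (hF : MapAssumption F R α β) (hR : 0 < R) {K : ℝ}
    (hK : ‖fderiv ℝ F 0‖ ≤ K) : 1 ≤ β * K := by
  obtain ⟨z, hz⟩ := exists_norm_eq (Vec N) zero_le_one
  have h1 := hF.norm_le_norm_fderiv (x := 0) (by simpa using hR) z
  have h2 := (fderiv ℝ F 0).le_of_opNorm_le hK z
  rw [hz] at h1 h2
  exact h1.trans (mul_le_mul_of_nonneg_left (by simpa using h2) hF.beta_pos.le)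

/-- One step of the dilation homotopy of `F'(0)⁻¹ ∘ F` is a residual block. -/
theorem exists_dilation_block (hF : MapAssumption F R α β) (hR : 1 ≤ R) {K : ℝ}
    (hK : ‖fderiv ℝ F 0‖ ≤ K) (B : Vec N ≃L[ℝ] Vec N)
    (hB : (B : Vec N →L[ℝ] Vec N) = fderiv ℝ F 0) {s t : ℝ} (ht : t ∈ Set.Ico (0 : ℝ) 1)
    (hs : s ∈ Set.Icc (0 : ℝ) 1) :
    ∃ f : Vec N → Vec N, Differentiable ℝ f ∧ ∀ x ∈ Metric.closedBall (0 : Vec N) 1,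
      dilation (B.symm ∘ F) s x = dilation (B.symm ∘ F) t x + f (dilation (B.symm ∘ F) t x) ∧
        ‖fderiv ℝ f (dilation (B.symm ∘ F) t x)‖ ≤ α * β ^ 2 * K * |s - t| := by
  have hα := hF.alpha_pos.le
  have hβ := hF.beta_pos.le
  have hK0 : 0 ≤ K := (norm_nonneg _).trans hK
  have hBz : ∀ z, fderiv ℝ F 0 z = B z := fun z => by rw [← hB]; rfl
  have hBl : ∀ w, ‖B.symm w‖ ≤ β * ‖w‖ := fun w => by
    have := hF.norm_le_norm_fderiv (x := 0) (by simpa using zero_lt_one.trans_le hR) (B.symm w)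
    simpa [hBz] using this
  have hBu : ∀ w, ‖w‖ ≤ K * ‖B.symm w‖ := fun w => by
    have := (fderiv ℝ F 0).le_of_opNorm_le hK (B.symm w)
    simpa [hBz] using this
  have hid : ∀ {r : ℝ} {x : Vec N}, r = 0 →
      (B.symm : Vec N →L[ℝ] Vec N).comp (fderiv ℝ F (r • x)) = ContinuousLinearMap.id ℝ _ := by
    rintro r x rfl
    ext1 z
    simp [hBz]
  -- As `t < 1`, this open set contains the closed unit ball, even when `R = 1`.
  set V : Set (Vec N) := {x | ‖t • x‖ < 1} with hV
  have hVo : IsOpen V := isOpen_lt (by fun_prop) continuous_const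
  have hSV : Metric.closedBall (0 : Vec N) 1 ⊆ V := by
    intro x hx
    rw [mem_closedBall_zero_iff] at hx
    change ‖t • x‖ < 1
    rw [norm_smul, Real.norm_eq_abs, abs_of_nonneg ht.1]
    nlinarith [ht.1, ht.2]
  have hVR : ∀ x ∈ V, ‖t • x‖ < R := fun x hx => lt_of_lt_of_le hx hR
  refine exists_residual_block hVo (isCompact_closedBall _ _) hSV
    (Φ' := fun x => (B.symm : Vec N →L[ℝ] Vec N).comp (fderiv ℝ F (t • x)))
    (Ψ' := fun x => (B.symm : Vec N →L[ℝ] Vec N).comp (fderiv ℝ F (s • x)))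
    (dilation_injective (B.symm.injective.comp F.injective) t).injOn
    (fun x hx => hasStrictFDerivAt_dilation
      (B.symm.hasStrictFDerivAt.comp _ (hF.hasStrictFDerivAt (hVR x hx))) hid)
    (fun x hx => B.symm.injective.comp (hF.fderiv_injective (hVR x hx)))
    (fun x _ => hasFDerivAt_dilation
      (B.symm.hasFDerivAt.comp _ (hF.differentiable _).hasFDerivAt) hid)
    (by positivity) fun x hx z => ?_
  have hx1 : ‖x‖ ≤ 1 := by simpa using hx
  have hsx : ‖s • x‖ ≤ R := by
    rw [norm_smul, Real.norm_eq_abs, abs_of_nonneg hs.1]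
    nlinarith [hs.1, hs.2, norm_nonneg x]
  have hst : ‖s • x - t • x‖ ≤ |s - t| := by
    rw [← sub_smul, norm_smul, Real.norm_eq_abs]
    exact mul_le_of_le_one_right (abs_nonneg _) hx1
  -- This gives the factor βK; the other β comes from `B.symm`.
  have h1 : ‖z‖ ≤ β * (K * ‖B.symm (fderiv ℝ F (t • x) z)‖) :=
    (hF.norm_le_norm_fderiv (hVR x (hSV hx)) z).trans
      (mul_le_mul_of_nonneg_left (hBu _) hβ)
  calc ‖B.symm (fderiv ℝ F (s • x) z) - B.symm (fderiv ℝ F (t • x) z)‖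
      = ‖B.symm ((fderiv ℝ F (s • x) - fderiv ℝ F (t • x)) z)‖ := by simp
    _ ≤ β * ‖(fderiv ℝ F (s • x) - fderiv ℝ F (t • x)) z‖ := hBl _
    _ ≤ β * (α * ‖s • x - t • x‖ * ‖z‖) :=
        mul_le_mul_of_nonneg_left (hF.smooth _ _ z hsx (hVR x (hSV hx)).le) hβ
    _ ≤ β * (α * |s - t| * (β * (K * ‖B.symm (fderiv ℝ F (t • x) z)‖))) := by gcongr
    _ = α * β ^ 2 * K * |s - t| * ‖B.symm (fderiv ℝ F (t • x) z)‖ := by ring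

end MapAssumption

theorem exists_linear_block {E : Type*} [NormedAddCommGroup E] [InnerProductSpace ℝ E]
    [FiniteDimensional ℝ E] {S T : E →L[ℝ] E} {δ : ℝ} (hδ : 0 ≤ δ)
    (hT : Function.Injective T) (h : ∀ z, ‖S z - T z‖ ≤ δ * ‖T z‖) :
    ∃ f : E → E, Differentiable ℝ f ∧ ∀ x, S x = T x + f (T x) ∧ ‖fderiv ℝ f (T x)‖ ≤ δ := by
  set e : E ≃L[ℝ] E :=
    (LinearEquiv.ofInjectiveEndo (T : E →ₗ[ℝ] E) hT).toContinuousLinearEquiv with he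
  have heT : ∀ x, T x = e x := fun x => rfl
  set g : E →L[ℝ] E := S.comp (e.symm : E →L[ℝ] E) - ContinuousLinearMap.id ℝ E with hg
  refine ⟨g, g.differentiable, fun x => ⟨by simp [hg, heT], ?_⟩⟩
  rw [g.fderiv]
  refine ContinuousLinearMap.opNorm_le_bound _ hδ fun w => ?_
  simpa [hg, heT] using h (e.symm w)

/-- The states of the network: `m` steps of the dilation homotopy followed by `n` linear steps. -/
theorem MapAssumption.exists_states {N : ℕ} [Nontrivial (Vec N)] {F : Vec N ≃ Vec N}
    {R α β K : ℝ} (hF : MapAssumption F R α β) (hR : 1 ≤ R) (hK : ‖fderiv ℝ F 0‖ ≤ K)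
    {m n : ℕ} (hm : 0 < m) (hn : 0 < n) {δ : ℝ} (h1 : α * β ^ 2 * K * (1 / m) ≤ δ)
    (h2 : (32 * N + (K + 1) * max 1 β) * (1 / n) ≤ δ) :
    ∃ Φ : ℕ → Vec N → Vec N, Φ 0 = id ∧ Φ (m + n) = F ∧
      ∀ l < m + n, ∃ f : Vec N → Vec N, Differentiable ℝ f ∧
        ∀ x ∈ Metric.closedBall (0 : Vec N) 1,
          Φ (l + 1) x = Φ l x + f (Φ l x) ∧ ‖fderiv ℝ f (Φ l x)‖ ≤ δ := by
  have hR0 : 0 < R := zero_lt_one.trans_le hR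
  have h00 : ‖(0 : Vec N)‖ < R := by simpa using hR0
  set B : Vec N ≃L[ℝ] Vec N := (LinearEquiv.ofInjectiveEndo (fderiv ℝ F 0 : Vec N →ₗ[ℝ] Vec N)
    (hF.fderiv_injective h00)).toContinuousLinearEquiv
  have hB : (B : Vec N →L[ℝ] Vec N) = fderiv ℝ F 0 := rfl
  have hBz : ∀ z, fderiv ℝ F 0 z = B z := fun z => rfl
  obtain ⟨γ, hγ0, hγ1, hγ⟩ := exists_linear_path (fderiv ℝ F 0) (hF.det_fderiv_zero_pos hR0) hK
    fun z => hF.norm_le_norm_fderiv h00 z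
  rw [finrank_euclideanSpace_fin] at hγ
  have hm' : (0 : ℝ) < m := Nat.cast_pos.2 hm
  have hn' : (0 : ℝ) < n := Nat.cast_pos.2 hn
  -- Comparison with `γ 0 = id`: the relative speed bound forces a kernel vector to vanish.
  have hγi : ∀ t ∈ Set.Icc (0 : ℝ) 1, Function.Injective (γ t) := by
    refine fun t ht => (injective_iff_map_eq_zero _).2 fun z hz => ?_
    have := hγ 0 (by simp) t ht z
    rw [hz, hγ0] at this
    simpa using this
  set G : Vec N → Vec N := B.symm ∘ F with hG
  have hstep : ∀ (k : ℕ) {c : ℝ}, 0 < c → |((k + 1 : ℕ) : ℝ) / c - k / c| = 1 / c := by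
    intro k c hc
    rw [← sub_div]
    push_cast
    rw [add_sub_cancel_left, abs_of_pos (by positivity)]
  refine ⟨fun l => if l ≤ m then dilation G (l / m) else fun x => γ ((l - m : ℕ) / n) (G x),
    ?_, ?_, fun l hl => ?_⟩
  · simp [dilation_zero]
  · have : ¬ m + n ≤ m := by omega
    simp only [this, if_false, add_tsub_cancel_left]
    rw [div_self hn'.ne', hγ1]
    ext1 x
    simp [hG, hBz]
  · rcases lt_or_ge l m with hlm | hlm
    · have hlm' : l + 1 ≤ m := hlm
      simp only [hlm', hlm.le, if_true]
      have hl1 : ((l + 1 : ℕ) : ℝ) ≤ m := Nat.cast_le.2 hlm'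
      have hl2 : (l : ℝ) < m := Nat.cast_lt.2 hlm
      obtain ⟨f, hf, hf'⟩ := hF.exists_dilation_block hR hK B hB (s := ((l + 1 : ℕ) : ℝ) / m)
        (t := (l : ℝ) / m) ⟨by positivity, (div_lt_one hm').2 hl2⟩
        ⟨by positivity, (div_le_one hm').2 hl1⟩
      refine ⟨f, hf, fun x hx => ⟨(hf' x hx).1, (hf' x hx).2.trans ?_⟩⟩
      rw [hstep l hm']
      exact h1
    · obtain ⟨k, rfl⟩ := Nat.exists_eq_add_of_le hlm
      have hk : k < n := by omega
      have hk1 : ((k + 1 : ℕ) : ℝ) ≤ n := Nat.cast_le.2 hk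
      have hk2 : (k : ℝ) ≤ n := Nat.cast_le.2 hk.le
      have e1 : ¬ m + k + 1 ≤ m := by omega
      -- At the junction `k = 0` the first branch applies; both agree, as `dilation G 1 = G` and `γ
      -- 0 = id`.
      have e2 : (if m + k ≤ m then dilation G ((m + k : ℕ) / m)
          else fun x => γ ((m + k - m : ℕ) / n) (G x)) = fun x => γ (k / n) (G x) := by
        rcases Nat.eq_zero_or_pos k with rfl | hk0
        · simp [div_self hm'.ne', dilation_one, hγ0]
        · have : ¬ m + k ≤ m := by omega
          simp only [this, if_false, add_tsub_cancel_left]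
      have e3 : m + k + 1 - m = k + 1 := by omega
      simp only [e2]
      simp only [e1, if_false, e3]
      have hkI : (k : ℝ) / n ∈ Set.Icc (0 : ℝ) 1 := ⟨by positivity, (div_le_one hn').2 hk2⟩
      have hδ : 0 ≤ δ := by
        refine le_trans ?_ h1
        have := hF.alpha_pos
        have := (norm_nonneg _).trans hK
        positivity
      obtain ⟨f, hf, hf'⟩ := exists_linear_block hδ (hγi _ hkI) (S := γ ((k + 1 : ℕ) / n))
        fun z => by
          refine (hγ _ ⟨by positivity, (div_le_one hn').2 hk1⟩ _ hkI z).trans ?_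
          rw [hstep k hn']
          gcongr
      exact ⟨f, hf, fun x _ => hf' (G x)⟩

/-! ### Constants and conclusion. -/

theorem div_le_gradientDelta {c α β : ℝ} (hc : 0 ≤ c) (hα : 0 ≤ α) (hβ : 0 ≤ β) {L : ℕ}
    (hL : 1 ≤ L) :
    c * max (α * β * (1 + β)) (β * (2 + α) + α) * (1 / L) ≤ gradientDelta (2 * c) α β L := by
  have hL' : (1 : ℝ) ≤ L := Nat.one_le_cast.2 hL
  have h1 : (1 : ℝ) / 2 ≤ Real.log (2 * L) := by
    have h2 : Real.log 2 ≤ Real.log (2 * L) := Real.log_le_log two_pos (by linarith)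
    linarith [Real.log_two_gt_d9]
  have hM : 0 ≤ max (α * β * (1 + β)) (β * (2 + α) + α) :=
    le_max_of_le_left (by positivity)
  rw [gradientDelta]
  calc c * max (α * β * (1 + β)) (β * (2 + α) + α) * (1 / L)
      = 2 * c * max (α * β * (1 + β)) (β * (2 + α) + α) * ((1 / 2) / L) := by ring
    _ ≤ _ := by gcongr

theorem theorem1 (N : ℕ) (K : ℝ) :
    ∃ c₁ : ℝ, 0 < c₁ ∧
      ∀ (F : Vec N ≃ Vec N) (R α β : ℝ), 1 ≤ R → MapAssumption F R α β →
        ‖fderiv ℝ F 0‖ ≤ K →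
        ∀ L : ℕ, 1 ≤ L →
          ∃ f : ℕ → Vec N → Vec N,
            (∀ l < L, Differentiable ℝ (f l)) ∧
            (∀ x : Vec N, ‖x‖ ≤ 1 → activation f x L = F x) ∧
            ∀ (E : Vec N → ℝ) (x : Vec N), ‖x‖ ≤ 1 → DifferentiableAt ℝ E (F x) →
              ∀ l < L,
                (1 - gradientDelta c₁ α β L) * ‖backpropGradient f L E x (l + 1)‖
                    ≤ ‖backpropGradient f L E x l‖ ∧
                ‖backpropGradient f L E x l‖
                    ≤ (1 + gradientDelta c₁ α β L) * ‖backpropGradient f L E x (l + 1)‖ := by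
  rcases Nat.eq_zero_or_pos N with rfl | hN
  · refine ⟨1, one_pos, fun F R α β _ _ _ L _ => ⟨fun _ _ => 0, fun _ _ =>
      differentiable_const _, fun x _ => Subsingleton.elim _ _, fun E x _ _ l _ => ?_⟩⟩
    simp [Subsingleton.elim (backpropGradient _ L E x _) 0]
  have : Nonempty (Fin N) := ⟨⟨0, hN⟩⟩
  have : Nontrivial (Vec N) := inferInstance
  set κ := max K 1 with hκ
  have hκ1 : 1 ≤ κ := le_max_right _ _
  -- The first term pays for the linear steps, `3 * κ` for the dilation steps; the final 1 is used
  -- for `L = 1`.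
  set c : ℝ := (32 * N + κ + 1) * κ + 3 * κ + 1 with hc
  have hc0 : 0 < c := by positivity
  refine ⟨2 * c, by positivity, fun F R α β hR hF hK' L hL => ?_⟩
  have hK : ‖fderiv ℝ F 0‖ ≤ κ := hK'.trans (le_max_left _ _)
  have hα := hF.alpha_pos
  have hβ := hF.beta_pos
  have hβκ : 1 ≤ β * κ := hF.one_le_mul (zero_lt_one.trans_le hR) hK
  have hL' : (1 : ℝ) ≤ L := Nat.one_le_cast.2 hL
  set M := max (α * β * (1 + β)) (β * (2 + α) + α) with hM
  have hδ : c * M * (1 / L) ≤ gradientDelta (2 * c) α β L :=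
    div_le_gradientDelta hc0.le hα.le hβ.le hL
  have hM1 : α * β ^ 2 ≤ M := le_max_of_le_left (by nlinarith [mul_pos hα hβ])
  have hM2 : 2 * β + α ≤ M := le_max_of_le_right (by nlinarith [mul_pos hα hβ])
  have hM0 : 0 < M := by linarith
  suffices h : ∃ Φ : ℕ → Vec N → Vec N, Φ 0 = id ∧ Φ L = F ∧
      ∀ l < L, ∃ f : Vec N → Vec N, Differentiable ℝ f ∧
        ∀ x ∈ Metric.closedBall (0 : Vec N) 1, Φ (l + 1) x = Φ l x + f (Φ l x) ∧
          ‖fderiv ℝ f (Φ l x)‖ ≤ gradientDelta (2 * c) α β L by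
    obtain ⟨Φ, h0, h1, h2⟩ := h
    obtain ⟨f, hf, hf1, hf2⟩ := exists_network_of_states (F := F) Φ (fun x _ => by rw [h0]; rfl)
      (fun x _ => by rw [h1]) h2
    exact ⟨f, hf, fun x hx => hf1 x (by simpa using hx),
      fun E x hx => hf2 E x (by simpa using hx)⟩
  -- A single block leaves no room for two stages; `F - id` works, with derivative at most α + κ +
  -- 1.
  rcases hL.eq_or_lt with rfl | hL2
  · refine ⟨fun l => if l = 0 then id else F, by simp, by simp, fun l hl => ?_⟩
    obtain rfl : l = 0 := by omega
    refine ⟨fun y => F y - y, hF.differentiable.sub differentiable_id, fun x hx => ⟨by simp, ?_⟩⟩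
    have hx1 : ‖x‖ ≤ 1 := by simpa using hx
    refine le_trans ?_ hδ
    have hd : fderiv ℝ (fun y => F y - y) x = (fderiv ℝ F x - fderiv ℝ F 0) + fderiv ℝ F 0 -
        ContinuousLinearMap.id ℝ _ := by
      rw [sub_add_cancel]
      exact ((hF.differentiable x).hasFDerivAt.sub (hasFDerivAt_id x)).fderiv
    simp only [if_true, id]
    rw [hd]
    have h1 : ‖fderiv ℝ F x - fderiv ℝ F 0‖ ≤ α := by
      refine (hF.norm_fderiv_sub_le (hx1.trans hR) (by simpa using zero_le_one.trans hR)).trans ?_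
      rw [sub_zero]; exact mul_le_of_le_one_right hα.le hx1
    have h2 := norm_sub_le ((fderiv ℝ F x - fderiv ℝ F 0) + fderiv ℝ F 0)
      (ContinuousLinearMap.id ℝ (Vec N))
    have h3 := norm_add_le (fderiv ℝ F x - fderiv ℝ F 0) (fderiv ℝ F 0)
    have h4 : ‖ContinuousLinearMap.id ℝ (Vec N)‖ ≤ 1 := ContinuousLinearMap.norm_id_le
    have h5 : κ + 1 ≤ (κ + 1) * κ * M := by
      have : 1 ≤ κ * M := by nlinarith
      nlinarith
    have h6 : (κ + 1) * κ * M + M ≤ c * M := by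
      have h7 : 0 ≤ 32 * (N : ℝ) * κ + 3 * κ := by positivity
      rw [hc]; nlinarith [mul_nonneg h7 hM0.le]
    simp only [Nat.cast_one, div_one, mul_one]
    linarith
  · obtain ⟨m, n, hm, hn, rfl, hmL, hnL⟩ : ∃ m n : ℕ, 0 < m ∧ 0 < n ∧ L = m + n ∧
        m + n ≤ 3 * m ∧ m + n ≤ 2 * n :=
      ⟨L / 2, L - L / 2, by omega, by omega, by omega, by omega, by omega⟩
    have hm' : (0 : ℝ) < m := Nat.cast_pos.2 hm
    have hn' : (0 : ℝ) < n := Nat.cast_pos.2 hn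
    have hmL' : ((m + n : ℕ) : ℝ) ≤ 3 * m := by exact_mod_cast hmL
    have hnL' : ((m + n : ℕ) : ℝ) ≤ 2 * n := by exact_mod_cast hnL
    have hLpos : (0 : ℝ) < (m + n : ℕ) := by linarith
    have hm2 : 1 / (m : ℝ) ≤ 3 * (1 / (m + n : ℕ)) := by
      rw [mul_one_div, div_le_div_iff₀ hm' hLpos]; linarith
    have hn2 : 1 / (n : ℝ) ≤ 2 * (1 / (m + n : ℕ)) := by
      rw [mul_one_div, div_le_div_iff₀ hn' hLpos]; linarith
    refine hF.exists_states hR hK hm hn ((?_ : _ ≤ _).trans hδ) ((?_ : _ ≤ _).trans hδ)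
    · calc α * β ^ 2 * κ * (1 / m) ≤ M * κ * (3 * (1 / (m + n : ℕ))) := by gcongr
        _ = 3 * κ * M * (1 / (m + n : ℕ)) := by ring
        _ ≤ c * M * (1 / (m + n : ℕ)) := by
          have : 3 * κ ≤ c := by
            rw [hc]; nlinarith [show 0 ≤ (32 * (N : ℝ) + κ + 1) * κ by positivity]
          gcongr
    · have h1 : 32 * N + (κ + 1) * max 1 β ≤ (32 * N + κ + 1) * κ * β := by
        have h2 : max 1 β ≤ κ * β := max_le (by linarith) (by nlinarith)
        have h3 : (1 : ℝ) ≤ κ * β := by linarith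
        have h4 : (κ + 1) * max 1 β ≤ (κ + 1) * (κ * β) := by gcongr
        have h5 : 32 * (N : ℝ) ≤ 32 * N * (κ * β) := le_mul_of_one_le_right (by positivity) h3
        linarith
      calc (32 * N + (κ + 1) * max 1 β) * (1 / n)
          ≤ (32 * N + κ + 1) * κ * β * (2 * (1 / (m + n : ℕ))) := by gcongr
        _ = (32 * N + κ + 1) * κ * (2 * β) * (1 / (m + n : ℕ)) := by ring
        _ ≤ c * M * (1 / (m + n : ℕ)) := by
          have : (32 * N + κ + 1) * κ ≤ c := by rw [hc]; linarith
          have : 2 * β ≤ M := by linarith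
          gcongr
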